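/- **Setting.** There are $R$ clients. Client $r\in[R]$ holds $n_r\ge 1$ data points with differentiable losses $F_{r,i}:\mathbb R^d\to\mathbb R$. Let $F_r=\frac1{n_r}\sum_{i=1}^{n_r}F_{r,i}$ and $F=\frac1R\sum_{r=1}^R F_r$. Suppose that, for some $\kappa\ge 0$, $\|\nabla F_r(x)-\nabla F(x)\|^2\le\kappa^2$ for all $x\in\mathbb R^d$ and all $r\in[R]$ (norms are $\ell_2$ norms), that $F$ is $L$-smooth with $L>0$ (that is, $\nabla F$ is $L$-Lipschitz), and that $x^*$ is a minimizer of $F$. An $\epsilon$ fraction of the $R$ clients, forming a set $B$ with $|B|=\epsilon R$, is corrupt. **Scheme.** Let $1\le K\le R$, $H\ge 1$, $\eta=\frac1{5HL}$. Synchronization takes place at the times $0,H,2H,\dots$, and the global model starts at $0$. At time $kH$ the server selects an arbitrary set $\mathcal K_{kH}$ of $K$ clients and sends them the global model $x$. Each selected client $r$ sets $x_r^{kH}=x$ and takes $H$ full-batch steps $x_r^{t+1}=x_r^t-\eta\nabla F_r(x_r^t)$. It then reports a vector $\tilde x_r$, which is its local model after these $H$ steps if $r\notin B$ and is arbitrary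 if $r\in B$. The server applies the filter below to the vectors $g_r=(x-\tilde x_r)/\eta$, $r\in\mathcal K_{kH}$, obtains $\hat g$, and replaces the global model by $x-\eta\hat g$. For $kH\le t<(k+1)H$ put $\mathcal K_t=\mathcal K_{kH}$ and $x^t=\frac1K\sum_{r\in\mathcal K_t}x_r^t$; here the local models $x_r^t$ of all selected clients, corrupt or not, follow the steps above. **Filter.** Let $\sigma_0^2=11H^2\kappa^2$ and $\alpha=1-\tilde\epsilon$, where in each round $\tilde\epsilon\le\frac14$ is any upper bound on the fraction of corrupt clients among the $K$ selected ones. Start with $\mathcal A=\mathcal K_{kH}$ and $c_i=1$. Repeat: let $(W,Y)$ be a solution (saddle point) of $$\max_{Y\succeq 0,\ \operatorname{tr}Y\le 1}\ \ \min_{0\le W_{ji}\le\frac{4-\alpha}{\alpha(2+\alpha)K},\ \sum_{j\in\mathcal A}W_{ji}=1}\ \ \sum_{i\in\mathcal A}c_i\tau_i,\qquad \tau_i=\Big(g_i-\sum_{j\in\mathcal A}W_{ji}g_j\Big)^{T}Y\Big(g_i-\sum_{j\in\mathcal A}W_{ji}g_j\Big).$$ If $\sum_{i\in\mathcal A}c_i\tau_i>4K\sigma_0^2$,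 replace $c_i$ by $(1-\tau_i/\max_{j\in\mathcal A}\tau_j)\,c_i$ for $i\in\mathcal A$, and remove from $\mathcal A$ all $i$ with $c_i<\frac12$; otherwise stop and return $\hat g=\frac1{|\mathcal A|}\sum_{i\in\mathcal A}g_i$. **Theorem.** There is an absolute constant $C\ge 0$ with the following property. In the above setting put $\varUpsilon_{\mathrm{GD}}=C\,H\kappa\sqrt\epsilon$ and $\varGamma_{\mathrm{GD}}=\frac{2\varUpsilon_{\mathrm{GD}}^2}{H}+25H\kappa^2$. If $\epsilon\le\frac{K}{4R}$, then every run of the scheme up to time $T$ (hence, with probability $1$, whatever random choices the server and the corrupt clients make) satisfies: * (strongly convex) if $F$ is $\mu$-strongly convex with $\mu>0$, then $$\|x^T-x^*\|^2\le\Big(1-\frac{\mu}{10HL}\Big)^T\|x^0-x^*\|^2+\frac{14}{\mu^2}\varGamma_{\mathrm{GD}};$$ * (non-convex) without any convexity assumption, if $T\ge1$, then $$\frac1T\sum_{t=0}^T\|\nabla F(x^t)\|^2\le\frac{10HL}{T}\big[F(x^0)-F(x^*)\big]+\frac{24}{5}\varGamma_{\mathrm{GD}}.$$ -/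

import Mathlib

open scoped Matrix

noncomputable section

namespace ByzLocalGD

/-- Parameter space `ℝ^d` with the `ℓ₂` norm. -/
abbrev Vec (d : ℕ) : Type := EuclideanSpace ℝ (Fin d)

/-! ### The objective -/

section Objective

/- `f r i` is the loss of data point `i` of client `r`, which holds `n r` data points. -/
variable {d R : ℕ} {n : Fin R → ℕ}

/-- Local loss of client `r`: the average of the losses of its data points. -/
def localLoss (f : (r : Fin R) → Fin (n r) → Vec d → ℝ) (r : Fin R) (x : Vec d) : ℝ :=
  (1 / (n r : ℝ)) * ∑ i, f r i x

/-- Global loss: the average of the local losses. -/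
def globalLoss (f : (r : Fin R) → Fin (n r) → Vec d → ℝ) (x : Vec d) : ℝ :=
  (1 / (R : ℝ)) * ∑ r, localLoss f r x

/-- Full-batch gradient of client `r`: the average of the gradients at all its data points. -/
def fullBatchGradient (f : (r : Fin R) → Fin (n r) → Vec d → ℝ) (r : Fin R) (x : Vec d) :
    Vec d :=
  (1 / (n r : ℝ)) • ∑ i, gradient (f r i) x

/-- Bounded gradient dissimilarity with constant `κ`. -/
def BoundedDissimilarity (f : (r : Fin R) → Fin (n r) → Vec d → ℝ) (κ : ℝ) : Prop :=
  ∀ (r : Fin R) (x : Vec d),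
    ‖gradient (localLoss f r) x - gradient (globalLoss f) x‖ ^ 2 ≤ κ ^ 2

end Objective

/-- `L`-smoothness: `F` is differentiable with `L`-Lipschitz gradient. -/
def IsSmoothWith {d : ℕ} (F : Vec d → ℝ) (L : ℝ) : Prop :=
  Differentiable ℝ F ∧ ∀ x y, ‖gradient F x - gradient F y‖ ≤ L * ‖x - y‖

/-- `μ`-strong convexity (for differentiable `F`). -/
def IsStronglyConvexWith {d : ℕ} (F : Vec d → ℝ) (μ : ℝ) : Prop :=
  ∀ x y, F y ≥ F x + inner ℝ (gradient F x) (y - x) + μ / 2 * ‖x - y‖ ^ 2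

/-! ### The filtering algorithm RAGE

It is run on the vectors `g i`, `i ∈ 𝒦`, where `ι` indexes the clients. -/

section RAGE

variable {d : ℕ} {ι : Type*}

/-- `g i - G_A w_i`, where `w_i` is the column `i` of `W`, indexed by `A`. -/
def resid (g : ι → Vec d) (A : Finset ι) (W : ι → ι → ℝ) (i : ι) : Vec d :=
  g i - ∑ j ∈ A, W j i • g j

/-- `τ_i = (g_i - G_A w_i)ᵀ Y (g_i - G_A w_i)`. -/
def tau (g : ι → Vec d) (A : Finset ι) (W : ι → ι → ℝ) (Y : Matrix (Fin d) (Fin d) ℝ)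
    (i : ι) : ℝ :=
  (resid g A W i).ofLp ⬝ᵥ (Y *ᵥ (resid g A W i).ofLp)

/-- The cost `Φ(W, Y) = ∑_{i ∈ A} c_i τ_i`. -/
def cost (g : ι → Vec d) (A : Finset ι) (c : ι → ℝ) (W : ι → ι → ℝ)
    (Y : Matrix (Fin d) (Fin d) ℝ) : ℝ :=
  ∑ i ∈ A, c i * tau g A W Y i

/-- Feasible weights: the columns indexed by `A` are probability vectors on `A` with entries at
most `(4 - α) / (α (2 + α) K)`, where `K` is the number of input vectors. -/
def FeasibleW (α : ℝ) (K : ℕ) (A : Finset ι) (W : ι → ι → ℝ) : Prop :=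
  ∀ i ∈ A, (∀ j ∈ A, 0 ≤ W j i ∧ W j i ≤ (4 - α) / (α * (2 + α) * K)) ∧ ∑ j ∈ A, W j i = 1

/-- Feasible `Y`: positive semidefinite with trace at most `1`. -/
def FeasibleY (Y : Matrix (Fin d) (Fin d) ℝ) : Prop :=
  Y.PosSemidef ∧ Y.trace ≤ 1

/-- `(W, Y)` solves the saddle point problem `max_Y min_W Φ(W, Y)`. -/
structure IsSaddle (α : ℝ) (K : ℕ) (g : ι → Vec d) (A : Finset ι) (c : ι → ℝ)
    (W : ι → ι → ℝ) (Y : Matrix (Fin d) (Fin d) ℝ) : Prop where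
  feasibleW : FeasibleW α K A W
  feasibleY : FeasibleY Y
  isMin : ∀ W', FeasibleW α K A W' → cost g A c W Y ≤ cost g A c W' Y
  isMax : ∀ Y', FeasibleY Y' → cost g A c W Y' ≤ cost g A c W Y

/-- `RageLoop α σsq K g A c out`: the loop, entered with the set `A` and the coefficients `c`, can
terminate and return `out`. It is a relation because the solution of the saddle point problem need
not be unique; any solution may be used. -/
inductive RageLoop (α σsq : ℝ) (K : ℕ) (g : ι → Vec d) :
    Finset ι → (ι → ℝ) → Vec d → Prop
  | done (A : Finset ι) (c : ι → ℝ) (W : ι → ι → ℝ) (Y : Matrix (Fin d) (Fin d) ℝ)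
      (hsaddle : IsSaddle α K g A c W Y)
      (hle : ∑ i ∈ A, c i * tau g A W Y i ≤ 4 * K * σsq) :
      RageLoop α σsq K g A c ((1 / (A.card : ℝ)) • ∑ i ∈ A, g i)
  | filter (A A' : Finset ι) (c c' : ι → ℝ) (W : ι → ι → ℝ) (Y : Matrix (Fin d) (Fin d) ℝ)
      (τmax : ℝ) (out : Vec d)
      (hsaddle : IsSaddle α K g A c W Y)
      (hgt : 4 * K * σsq < ∑ i ∈ A, c i * tau g A W Y i)
      (hmax : IsGreatest (tau g A W Y '' (A : Set ι)) τmax)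
      (hc' : ∀ i ∈ A, c' i = (1 - tau g A W Y i / τmax) * c i)
      (hA' : ∀ i, i ∈ A' ↔ i ∈ A ∧ 1 / 2 ≤ c' i)
      (hnext : RageLoop α σsq K g A' c' out) :
      RageLoop α σsq K g A c out

/-- `out` is a possible output of RAGE with parameters `ε̃` and `σ₀²` on the vectors
`g i`, `i ∈ 𝒦`. -/
def IsRageOutput (epst σsq : ℝ) (𝒦 : Finset ι) (g : ι → Vec d) (out : Vec d) : Prop :=
  RageLoop (1 - epst) σsq 𝒦.card g 𝒦 (fun _ => 1) out

end RAGE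

/-! ### The local gradient descent scheme -/

section Scheme

variable {d R : ℕ} {n : Fin R → ℕ}

/-- Local model of client `r` after `s` full-batch gradient steps with step size `η` from `x`. -/
def localModel (f : (r : Fin R) → Fin (n r) → Vec d → ℝ) (η : ℝ) (r : Fin R) (x : Vec d)
    (s : ℕ) : Vec d :=
  (fun z => z - η • fullBatchGradient f r z)^[s] x

/-- A run up to time `T` of the Byzantine-resilient local scheme with full-batch gradients.
The synchronization indices are `0, H, 2H, …`, and round `k` lasts from time `k H` to `(k + 1) H`.
`B` is the set of corrupt clients, `act k` the set of clients selected by the server in round `k`,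
`x k` the global model at the beginning of round `k`, and `sent k r` the vector that client `r`
reports at the end of round `k`. The parameter `ε̃` of RAGE is any bound, of at most `1/4`, on the
fraction of corrupt clients among the selected ones. -/
structure IsRun (f : (r : Fin R) → Fin (n r) → Vec d → ℝ) (B : Finset (Fin R))
    (η σsq : ℝ) (K H T : ℕ) (act : ℕ → Finset (Fin R)) (x : ℕ → Vec d)
    (sent : ℕ → Fin R → Vec d) : Prop where
  init : x 0 = 0
  card_act : ∀ k, k * H ≤ T → (act k).card = K
  honest : ∀ k, (k + 1) * H ≤ T → ∀ r ∈ act k, r ∉ B → sent k r = localModel f η r (x k) H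
  update : ∀ k, (k + 1) * H ≤ T → ∃ (epst : ℝ) (ghat : Vec d),
    ((act k ∩ B).card : ℝ) / K ≤ epst ∧ epst ≤ 1 / 4 ∧
    IsRageOutput epst σsq (act k) (fun r => (1 / η) • (x k - sent k r)) ghat ∧
    x (k + 1) = x k - η • ghat

/-- Average iterate at time `t`: the average of the local models of the active clients, where
`t = k H + s` with `s < H` is step `s` of round `k`. Between synchronization indices the local
model of every active client evolves by gradient descent; corrupt clients deviate in `sent`. -/
def avgIterate (f : (r : Fin R) → Fin (n r) → Vec d → ℝ) (η : ℝ) (K H : ℕ)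
    (act : ℕ → Finset (Fin R)) (x : ℕ → Vec d) (t : ℕ) : Vec d :=
  (1 / (K : ℝ)) • ∑ r ∈ act (t / H), localModel f η r (x (t / H)) (t % H)

end Scheme

/-- `Γ_GD` as a function of `Υ_GD`, `H` and `κ`. -/
def Gam (Ups : ℝ) (H : ℕ) (κ : ℝ) : ℝ :=
  2 * Ups ^ 2 / H + 25 * H * κ ^ 2

end ByzLocalGD

end

open ByzLocalGD

/-! ### Inexact gradient steps on a smooth function -/

section Analysis

variable {d : ℕ}

/-! The average iterate performs gradient descent on the global loss `F` with an error. Dividing by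
`η` the distance of its step from `w - η ∇F(w)` gives at most `3/2 κ` inside a round and `53/5 H κ`
at a synchronization (`norm_avgIterate_step_le`). Only one step in `H` carries the large error, so
the mean squared error is at most `115 H κ²`, below `24/5 · 25 H κ²`. Descent with telescoping, or
contraction in the strongly convex case, then gives both bounds from the term `25 H κ²` of `Gam`
alone.

Inside a round every client is compared with exact gradient descent on `F` from the same start. Its
gradient is wrong by at most `κ` at its own point and `∇F` is Lipschitz, so it drifts by `O(η κ s)`
in `s` steps; no smoothness of the local losses is needed.

At a synchronization the honest inputs of the filter therefore lie in a ball of radius `ρ = O(H κ)`,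
whose centre `m` is the displacement of exact descent over `η`. While the filter runs, the honest
vectors carry at most `1/35` of the cost, so honest clients lose little mass
(`FilterInvariant.step`). When it stops, the cost is small in every direction, and the cap on the
weights prevents the corrupt vectors from explaining one another; so their mean deviation along any
direction is `O(H κ)` (`abs_sum_le_of_filter_stops`). The argument is deterministic and works for
any adversary with at most a quarter of the selected clients. -/

theorem gradient_localLoss {R : ℕ} {n : Fin R → ℕ} {f : (r : Fin R) → Fin (n r) → Vec d → ℝ}
    (hf : ∀ r i, Differentiable ℝ (f r i)) (r : Fin R) (x : Vec d) :
    gradient (localLoss f r) x = fullBatchGradient f r x := by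
  have h1 : HasFDerivAt (localLoss f r)
      ((1 / (n r : ℝ)) • ∑ i, InnerProductSpace.toDual ℝ (Vec d) (gradient (f r i) x)) x := by
    have h2 : HasFDerivAt (fun y => ∑ i, f r i y)
        (∑ i, InnerProductSpace.toDual ℝ (Vec d) (gradient (f r i) x)) x :=
      HasFDerivAt.fun_sum fun i _ => (hf r i x).hasGradientAt.hasFDerivAt
    exact h2.const_mul (1 / (n r : ℝ))
  refine HasGradientAt.gradient ?_
  rw [hasGradientAt_iff_hasFDerivAt]
  refine h1.congr_fderiv ?_
  rw [fullBatchGradient, map_smul, map_sum]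

namespace ByzLocalGD.IsSmoothWith

variable {F : Vec d → ℝ} {L : ℝ}

/-- The quadratic upper bound for a function with Lipschitz gradient. -/
theorem le_add_inner (h : IsSmoothWith F L) (x v : Vec d) :
    F (x + v) ≤ F x + inner ℝ (gradient F x) v + L / 2 * ‖v‖ ^ 2 := by
  have hline : ∀ t : ℝ, HasDerivAt (fun t : ℝ => x + t • v) v t := fun t => by
    simpa using ((hasDerivAt_id t).smul_const v).const_add x
  have hF : ∀ t : ℝ, HasDerivAt (fun t : ℝ => F (x + t • v))
      (inner ℝ (gradient F (x + t • v)) v) t := fun t => by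
    have h1 := ((h.1 (x + t • v)).hasGradientAt.hasFDerivAt).comp_hasDerivAt t (hline t)
    exact h1
  have hφ : ∀ t : ℝ, HasDerivAt
      (fun t : ℝ => F (x + t • v) - (t * inner ℝ (gradient F x) v + L / 2 * ‖v‖ ^ 2 * t ^ 2))
      (inner ℝ (gradient F (x + t • v)) v
        - (inner ℝ (gradient F x) v + L * ‖v‖ ^ 2 * t)) t := fun t => by
    have h2 := (hF t).sub (((hasDerivAt_id t).mul_const (inner ℝ (gradient F x) v)).add
      ((hasDerivAt_pow 2 t).const_mul (L / 2 * ‖v‖ ^ 2)))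
    refine h2.congr_deriv ?_
    simp only [one_mul, Nat.cast_ofNat, Nat.add_one_sub_one, pow_one]
    ring
  have hanti := antitoneOn_of_deriv_nonpos (convex_Icc (0 : ℝ) 1)
    (fun t _ => (hφ t).continuousAt.continuousWithinAt)
    (fun t _ => (hφ t).differentiableAt.differentiableWithinAt) (fun t ht => by
      rw [interior_Icc] at ht
      rw [(hφ t).deriv]
      have h3 := real_inner_le_norm (gradient F (x + t • v) - gradient F x) v
      have h4 := h.2 (x + t • v) x
      rw [add_sub_cancel_left, norm_smul, Real.norm_of_nonneg ht.1.le] at h4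
      rw [inner_sub_left] at h3
      nlinarith [mul_le_mul_of_nonneg_right h4 (norm_nonneg v)])
  have h5 := hanti (Set.left_mem_Icc.2 zero_le_one) (Set.right_mem_Icc.2 zero_le_one) zero_le_one
  simp only [one_smul, zero_smul, add_zero] at h5
  linarith

theorem norm_gradient_sq_le (h : IsSmoothWith F L) (hL : 0 < L) {xs : Vec d}
    (hmin : IsMinOn F Set.univ xs) (x : Vec d) :
    ‖gradient F x‖ ^ 2 ≤ 2 * L * (F x - F xs) := by
  have h1 := h.le_add_inner x (-(1 / L) • gradient F x)
  have h2 := (isMinOn_iff.1 hmin) (x + -(1 / L) • gradient F x) (Set.mem_univ _)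
  rw [inner_smul_right, real_inner_self_eq_norm_sq, norm_smul, mul_pow, Real.norm_eq_abs,
    sq_abs] at h1
  have h3 : F x + -(1 / L) * ‖gradient F x‖ ^ 2 + L / 2 * ((-(1 / L)) ^ 2 * ‖gradient F x‖ ^ 2)
      = F x - ‖gradient F x‖ ^ 2 / (2 * L) := by
    field_simp
    ring
  have h4 : ‖gradient F x‖ ^ 2 / (2 * L) ≤ F x - F xs := by linarith
  rw [div_le_iff₀ (by positivity)] at h4
  linarith

/-- One inexact gradient step decreases a smooth function up to the squared error. -/
theorem inexact_step (h : IsSmoothWith F L) {η δ : ℝ} (hη : 0 ≤ η) (hηL : η * L ≤ 1)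
    {w w' : Vec d} (hw : ‖w' - (w - η • gradient F w)‖ ≤ η * δ) :
    F w' ≤ F w - η / 2 * ‖gradient F w‖ ^ 2 + η / 2 * δ ^ 2 := by
  rcases hη.eq_or_lt with rfl | hη'
  · have : w' = w := by simpa [sub_eq_zero] using hw
    simp [this]
  set g := gradient F w with hg
  obtain ⟨e, he⟩ : ∃ e, w' = w + -η • (g + e) := by
    refine ⟨-(1 / η) • (w' - w) - g, ?_⟩
    rw [add_sub_cancel, smul_smul]
    field_simp
    simp
  have hee : w' - (w - η • g) = -η • e := by rw [he]; module
  have hδ : ‖e‖ ≤ δ := by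
    rw [hee, norm_smul, norm_neg, Real.norm_of_nonneg hη] at hw
    exact le_of_mul_le_mul_left hw hη'
  have h1 := h.le_add_inner w (-η • (g + e))
  rw [← he, ← hg, inner_smul_right, inner_add_right, real_inner_self_eq_norm_sq, norm_smul, mul_pow,
    norm_neg, Real.norm_of_nonneg hη, norm_add_sq_real] at h1
  have h2 := norm_add_sq_real g e
  -- Completing the square leaves exactly half of this term to discard; this uses `η L ≤ 1`.
  have h3 : 0 ≤ η * (1 - η * L) * ‖g + e‖ ^ 2 := by
    have : 0 ≤ 1 - η * L := by linarith
    positivity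
  have h5 : ‖e‖ ^ 2 ≤ δ ^ 2 := by gcongr
  rw [h2] at h3
  have h6 := mul_le_mul_of_nonneg_left h5 hη
  linarith

end ByzLocalGD.IsSmoothWith

theorem ByzLocalGD.IsStronglyConvexWith.le_lipschitz [Nontrivial (Vec d)] {F : Vec d → ℝ}
    {L μ : ℝ} (h : IsSmoothWith F L) (hsc : IsStronglyConvexWith F μ) : μ ≤ L := by
  obtain ⟨v, hv⟩ := exists_ne (0 : Vec d)
  have h1 := hsc 0 v
  have h2 := h.le_add_inner 0 v
  rw [zero_add] at h2
  rw [sub_zero, zero_sub, norm_neg] at h1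
  have : 0 < ‖v‖ ^ 2 := by positivity
  nlinarith

/-- One inexact gradient step contracts the distance to the minimizer of a strongly convex
function up to the squared error. -/
theorem ByzLocalGD.IsStronglyConvexWith.inexact_step {F : Vec d → ℝ} {L μ η δ : ℝ}
    (h : IsSmoothWith F L) (hsc : IsStronglyConvexWith F μ) (hμ : 0 < μ) (hμL : μ ≤ L)
    (hη : 0 < η) (hηL : η * L ≤ 1 / 5) {xs : Vec d} (hmin : IsMinOn F Set.univ xs)
    {w w' : Vec d} (hw : ‖w' - (w - η • gradient F w)‖ ≤ η * δ) :
    ‖w' - xs‖ ^ 2 ≤ (1 - η * μ / 2) * ‖w - xs‖ ^ 2 + η / μ * δ ^ 2 := by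
  have hL : 0 < L := hμ.trans_le hμL
  set g := gradient F w with hg
  set D := ‖w - xs‖ ^ 2 with hD
  set Δ := F w - F xs with hΔ
  have hg2 : ‖g‖ ^ 2 ≤ 2 * L * Δ := h.norm_gradient_sq_le hL hmin w
  have hgs : gradient F xs = 0 := by
    have := h.norm_gradient_sq_le hL hmin xs
    rw [sub_self, mul_zero] at this
    exact norm_eq_zero.1 (pow_eq_zero_iff two_ne_zero |>.1 (le_antisymm this (sq_nonneg _)))
  have h1 : Δ + μ / 2 * D ≤ inner ℝ g (w - xs) := by
    have := hsc w xs
    rw [← neg_sub w xs, inner_neg_right] at this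
    linarith
  have h2 : μ / 2 * D ≤ Δ := by
    have := hsc xs w
    rw [hgs, inner_zero_left, norm_sub_rev] at this
    linarith
  have hx : η * μ ≤ 1 / 5 := (mul_le_mul_of_nonneg_left hμL hη.le).trans hηL
  set p := w - xs - η • g with hp
  -- The inner product gives `-2ηΔ - ημD` and smoothness gives back at most `2/5 ηΔ`. By quadratic
  -- growth the remaining `-8/5 ηΔ` is at most `-4/5 ημD`.
  have hp2 : ‖p‖ ^ 2 ≤ (1 - 9 / 5 * (η * μ)) * D := by
    have e1 : ‖p‖ ^ 2 = D - 2 * (η * inner ℝ g (w - xs)) + η ^ 2 * ‖g‖ ^ 2 := by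
      rw [hp, norm_sub_sq_real, inner_smul_right, real_inner_comm, norm_smul, mul_pow,
        Real.norm_of_nonneg hη.le]
    have e2 : η ^ 2 * ‖g‖ ^ 2 ≤ 2 / 5 * η * Δ := by
      have hΔ0 : 0 ≤ Δ := le_trans (by positivity) h2
      calc η ^ 2 * ‖g‖ ^ 2 ≤ η ^ 2 * (2 * L * Δ) := by gcongr
        _ = 2 * (η * L) * (η * Δ) := by ring
        _ ≤ 2 * (1 / 5) * (η * Δ) := by gcongr
        _ = _ := by ring
    have e3 := mul_le_mul_of_nonneg_left h1 hη.le
    have e4 := mul_le_mul_of_nonneg_left h2 hη.le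
    rw [e1]
    linarith
  set e := w' - (w - η • g) with he
  have hw' : w' - xs = p + e := by rw [he, hp]; abel
  -- Young parameter: `13/10 - 9/5 = -1/2` gives the contraction rate, and `ημ + 10/13 ≤ 1` keeps
  -- the coefficient of the error at `η/μ`.
  have hb : 0 < 13 / 10 * (η * μ) := by positivity
  have h3 : ‖p + e‖ ^ 2 ≤ (1 + 13 / 10 * (η * μ)) * ‖p‖ ^ 2
      + (1 + 1 / (13 / 10 * (η * μ))) * ‖e‖ ^ 2 := by
    set b := 13 / 10 * (η * μ)
    have i1 : ‖p + e‖ ^ 2 ≤ (‖p‖ + ‖e‖) ^ 2 := by gcongr; exact norm_add_le _ _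
    have i2 : 0 ≤ 1 / b * (b * ‖p‖ - ‖e‖) ^ 2 := by positivity
    have i3 : 1 / b * (b * ‖p‖ - ‖e‖) ^ 2
        = b * ‖p‖ ^ 2 - 2 * (‖p‖ * ‖e‖) + 1 / b * ‖e‖ ^ 2 := by
      field_simp
      ring
    linarith
  have h4 : (1 + 13 / 10 * (η * μ)) * ‖p‖ ^ 2 ≤ (1 - η * μ / 2) * D := by
    calc _ ≤ (1 + 13 / 10 * (η * μ)) * ((1 - 9 / 5 * (η * μ)) * D) := by gcongr
      _ ≤ _ := by
        have : 0 ≤ (η * μ) ^ 2 * D := by positivity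
        linarith
  have h5 : (1 + 1 / (13 / 10 * (η * μ))) * ‖e‖ ^ 2 ≤ η / μ * δ ^ 2 := by
    have j1 : ‖e‖ ^ 2 ≤ (η * δ) ^ 2 := by gcongr
    have j2 : (1 + 1 / (13 / 10 * (η * μ))) * (η * δ) ^ 2
        = η / μ * δ ^ 2 * (η * μ + 10 / 13) := by
      field_simp
    calc _ ≤ (1 + 1 / (13 / 10 * (η * μ))) * (η * δ) ^ 2 := by gcongr
      _ = η / μ * δ ^ 2 * (η * μ + 10 / 13) := j2
      _ ≤ η / μ * δ ^ 2 * 1 := by gcongr; linarith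
      _ = _ := mul_one _
  rw [hw']
  linarith

end Analysis

/-! ### Robustness of the filter -/

section Filter

/-- Factor `Y = XᵀX` and apply Cauchy–Schwarz to each row of `X`. -/
theorem Matrix.PosSemidef.dotProduct_mulVec_le_trace {n : Type*} [Fintype n]
    {Y : Matrix n n ℝ} (hY : Y.PosSemidef) (v : n → ℝ) :
    v ⬝ᵥ (Y *ᵥ v) ≤ Y.trace * (v ⬝ᵥ v) := by
  classical
  open scoped MatrixOrder in
  obtain ⟨X, rfl⟩ := CStarAlgebra.nonneg_iff_eq_star_mul_self.1 hY.nonneg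
  have h1 : v ⬝ᵥ ((star X * X) *ᵥ v) = ∑ i, (X i ⬝ᵥ v) ^ 2 := by
    rw [← Matrix.mulVec_mulVec, Matrix.dotProduct_mulVec, Matrix.star_eq_conjTranspose,
      Matrix.conjTranspose_eq_transpose_of_trivial, Matrix.vecMul_transpose]
    simp [dotProduct, Matrix.mulVec, sq]
  have h2 : (star X * X).trace = ∑ i, X i ⬝ᵥ X i := by
    rw [Matrix.trace_mul_comm]
    simp [Matrix.trace, Matrix.mul_apply, dotProduct, Matrix.star_apply]
  rw [h1, h2, Finset.sum_mul]
  refine Finset.sum_le_sum fun i _ => ?_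
  simpa [dotProduct, sq] using Finset.sum_mul_sq_le_sq_mul_sq Finset.univ (X i) v

theorem sum_norm_sub_mean_sq_le {E ι : Type*} [NormedAddCommGroup E] [InnerProductSpace ℝ E]
    (G : Finset ι) (g : ι → E) (m : E) :
    ∑ i ∈ G, ‖g i - ∑ j ∈ G, (1 / (G.card : ℝ)) • g j‖ ^ 2 ≤ ∑ i ∈ G, ‖g i - m‖ ^ 2 := by
  rcases G.eq_empty_or_nonempty with rfl | hG
  · simp
  have hc : (G.card : ℝ) ≠ 0 := by exact_mod_cast hG.card_pos.ne'
  set a := ∑ j ∈ G, (1 / (G.card : ℝ)) • g j with ha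
  have h1 : ∑ i ∈ G, (g i - a) = 0 := by
    rw [Finset.sum_sub_distrib, Finset.sum_const, ha, ← Finset.smul_sum, ← Nat.cast_smul_eq_nsmul ℝ,
      smul_smul, mul_one_div_cancel hc, one_smul, sub_self]
  have h2 : ∀ i, ‖g i - m‖ ^ 2
      = ‖g i - a‖ ^ 2 + 2 * inner ℝ (g i - a) (a - m) + ‖a - m‖ ^ 2 := fun i => by
    rw [← norm_add_sq_real, sub_add_sub_cancel]
  simp_rw [h2, Finset.sum_add_distrib, ← Finset.mul_sum, ← sum_inner, h1, inner_zero_left]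
  have : 0 ≤ ∑ i ∈ G, ‖a - m‖ ^ 2 := Finset.sum_nonneg fun _ _ => sq_nonneg _
  linarith

variable {d : ℕ} {ι : Type*}

theorem tau_nonneg {Y : Matrix (Fin d) (Fin d) ℝ} (hY : Y.PosSemidef) (g : ι → Vec d)
    (A : Finset ι) (W : ι → ι → ℝ) (i : ι) : 0 ≤ tau g A W Y i := by
  have := hY.dotProduct_mulVec_nonneg (resid g A W i).ofLp
  rwa [star_trivial] at this

theorem tau_le_norm_sq {Y : Matrix (Fin d) (Fin d) ℝ} (hY : FeasibleY Y) (g : ι → Vec d)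
    (A : Finset ι) (W : ι → ι → ℝ) (i : ι) : tau g A W Y i ≤ ‖resid g A W i‖ ^ 2 := by
  refine (hY.1.dotProduct_mulVec_le_trace _).trans ?_
  have h1 : ‖resid g A W i‖ ^ 2 = (resid g A W i).ofLp ⬝ᵥ (resid g A W i).ofLp := by
    rw [EuclideanSpace.real_norm_sq_eq]
    simp [dotProduct, sq]
  rw [h1]
  refine mul_le_of_le_one_left ?_ hY.2
  rw [← h1]
  positivity

/-- Rank-one competitors for `Y` turn a bound on the saddle value into a bound on the residuals
along every direction. -/
theorem tau_vecMulVec (g : ι → Vec d) (A : Finset ι) (W : ι → ι → ℝ) (u : Vec d) (i : ι) :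
    tau g A W (Matrix.vecMulVec u.ofLp u.ofLp) i = inner ℝ u (resid g A W i) ^ 2 := by
  rw [tau, Matrix.vecMulVec_mulVec, EuclideanSpace.inner_eq_star_dotProduct]
  simp [sq, dotProduct_comm]

theorem feasibleY_vecMulVec {u : Vec d} (hu : ‖u‖ = 1) :
    FeasibleY (Matrix.vecMulVec u.ofLp u.ofLp) := by
  constructor
  · simpa using Matrix.posSemidef_vecMulVec_self_star u.ofLp
  · have h := EuclideanSpace.real_norm_sq_eq u
    rw [hu] at h
    rw [Matrix.trace_vecMulVec]
    simp only [dotProduct, ← sq]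
    linarith

variable [DecidableEq ι]

/-- The state `(A, c)` of the filter on the inputs `𝒦`: the coefficients stay in `[1/2, 1]`, and
the mass taken from the clients outside `B` is a small multiple of the mass taken from `B`. -/
structure FilterInvariant (𝒦 B A : Finset ι) (c : ι → ℝ) : Prop where
  subset : A ⊆ 𝒦
  half_le : ∀ i ∈ A, 1 / 2 ≤ c i
  le_one : ∀ i ∈ A, c i ≤ 1
  mass : ∑ i ∈ 𝒦 \ B, (if i ∈ A then 1 - c i else 1 / 2)
    ≤ 1 / 34 * ∑ i ∈ 𝒦 ∩ B, (if i ∈ A then 1 - c i else 1)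

theorem FilterInvariant.initial (𝒦 B : Finset ι) : FilterInvariant 𝒦 B 𝒦 (fun _ => 1) where
  subset := subset_rfl
  half_le _ _ := by norm_num
  le_one _ _ := le_rfl
  mass := by
    rw [Finset.sum_eq_zero, Finset.sum_eq_zero, mul_zero]
    · intro i hi; simp [(Finset.mem_inter.1 hi).1]
    · intro i hi; simp [(Finset.mem_sdiff.1 hi).1]

/-- Few clients outside `B` have been removed. -/
theorem FilterInvariant.card_sdiff_le {𝒦 B A : Finset ι} {c : ι → ℝ}
    (h : FilterInvariant 𝒦 B A c) :
    (𝒦.card : ℝ) - 18 / 17 * (𝒦 ∩ B).card ≤ (A \ B).card := by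
  -- Each removed honest client weighs `1/2` and the corrupt mass is at most `|𝒦 ∩ B|`, so at most
  -- `|𝒦 ∩ B| / 17` honest clients are gone.
  have h1 : (1 / 2 : ℝ) * ((𝒦 \ B) \ A).card
      ≤ ∑ i ∈ 𝒦 \ B, (if i ∈ A then 1 - c i else 1 / 2) := by
    rw [← Finset.sum_inter_add_sum_sdiff (𝒦 \ B) A]
    have e1 : ∑ i ∈ (𝒦 \ B) \ A, (if i ∈ A then 1 - c i else 1 / 2)
        = 1 / 2 * (((𝒦 \ B) \ A).card : ℝ) := by
      rw [Finset.sum_congr rfl fun i hi => if_neg (Finset.mem_sdiff.1 hi).2, Finset.sum_const,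
        nsmul_eq_mul, mul_comm]
    have e2 : 0 ≤ ∑ i ∈ (𝒦 \ B) ∩ A, (if i ∈ A then 1 - c i else 1 / 2) :=
      Finset.sum_nonneg fun i hi => by
        have hi' := (Finset.mem_inter.1 hi).2
        rw [if_pos hi']
        linarith [h.le_one i hi']
    linarith
  have h2 : ∑ i ∈ 𝒦 ∩ B, (if i ∈ A then 1 - c i else 1) ≤ ((𝒦 ∩ B).card : ℝ) := by
    refine (Finset.sum_le_card_nsmul _ _ 1 fun i _ => ?_).trans_eq (by simp)
    split_ifs with hi
    · linarith [h.half_le i hi]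
    · exact le_rfl
  have h3 : ((𝒦 ∩ B).card : ℝ) + (𝒦 \ B).card = 𝒦.card := by
    exact_mod_cast Finset.card_inter_add_card_sdiff 𝒦 B
  have h4 : (((𝒦 \ B) ∩ A).card : ℝ) + ((𝒦 \ B) \ A).card = (𝒦 \ B).card := by
    exact_mod_cast Finset.card_inter_add_card_sdiff (𝒦 \ B) A
  have h5 : (((𝒦 \ B) ∩ A).card : ℝ) ≤ (A \ B).card := by
    exact_mod_cast Finset.card_le_card fun i hi => by
      simp only [Finset.mem_inter, Finset.mem_sdiff] at hi ⊢
      tauto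
  linarith [h.mass]

variable {𝒦 B A : Finset ι} {c : ι → ℝ} {g : ι → Vec d} {W : ι → ι → ℝ}
  {Y : Matrix (Fin d) (Fin d) ℝ} {epst σ ρ : ℝ} {m : Vec d}

/-- The clients outside `B` contribute at most their variance to the optimal cost. -/
theorem ByzLocalGD.IsSaddle.sum_sdiff_le {α : ℝ} {K : ℕ} (hs : IsSaddle α K g A c W Y)
    (hne : (A \ B).Nonempty) (hcap : 1 / ((A \ B).card : ℝ) ≤ (4 - α) / (α * (2 + α) * K))
    (hc1 : ∀ i ∈ A, c i ≤ 1)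
    (hg : ∀ i ∈ A \ B, ‖g i - m‖ ≤ ρ) :
    ∑ i ∈ A \ B, c i * tau g A W Y i ≤ (A \ B).card * ρ ^ 2 := by
  set G := A \ B with hG
  have hGA : G ⊆ A := Finset.sdiff_subset
  have hGc : (0 : ℝ) < G.card := by exact_mod_cast hne.card_pos
  -- Column `i` enters only `τ_i`, so changing the honest columns alone leaves the corrupt terms to
  -- cancel.
  set W' : ι → ι → ℝ := fun j i => if i ∈ G then (if j ∈ G then 1 / (G.card : ℝ) else 0) else W j i
    with hW'
  have hfeas : FeasibleW α K A W' := by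
    intro i hi
    by_cases hiG : i ∈ G
    · have hcap0 : 0 ≤ (4 - α) / (α * (2 + α) * K) := le_trans (by positivity) hcap
      refine ⟨fun j _ => ?_, ?_⟩
      · simp only [hW', if_pos hiG]
        split_ifs
        · exact ⟨by positivity, hcap⟩
        · exact ⟨le_rfl, hcap0⟩
      · simp only [hW', if_pos hiG]
        rw [← Finset.sum_filter, Finset.filter_mem_eq_inter, Finset.inter_eq_right.2 hGA,
          Finset.sum_const, nsmul_eq_mul, mul_one_div_cancel hGc.ne']
    · simpa only [hW', if_neg hiG] using hs.feasibleW i hi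
  have hres : ∀ i ∈ G, resid g A W' i = g i - ∑ j ∈ G, (1 / (G.card : ℝ)) • g j := by
    intro i hi
    simp only [resid, hW', if_pos hi, ite_smul, zero_smul]
    rw [← Finset.sum_filter, Finset.filter_mem_eq_inter, Finset.inter_eq_right.2 hGA]
  have hmin := hs.isMin W' hfeas
  rw [cost, cost, ← Finset.sum_inter_add_sum_sdiff A B,
    ← Finset.sum_inter_add_sum_sdiff A B (fun i => c i * tau g A W' Y i), ← hG] at hmin
  have hsame : ∑ i ∈ A ∩ B, c i * tau g A W' Y i = ∑ i ∈ A ∩ B, c i * tau g A W Y i := by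
    refine Finset.sum_congr rfl fun i hi => ?_
    have hiG : i ∉ G := fun h => (Finset.mem_sdiff.1 h).2 (Finset.mem_inter.1 hi).2
    simp only [tau, resid, hW', if_neg hiG]
  calc ∑ i ∈ G, c i * tau g A W Y i ≤ ∑ i ∈ G, c i * tau g A W' Y i := by linarith
    _ ≤ ∑ i ∈ G, ‖g i - ∑ j ∈ G, (1 / (G.card : ℝ)) • g j‖ ^ 2 := by
      refine Finset.sum_le_sum fun i hi => ?_
      rw [← hres i hi]
      exact (mul_le_of_le_one_left (tau_nonneg hs.feasibleY.1 _ _ _ _) (hc1 i (hGA hi))).trans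
        (tau_le_norm_sq hs.feasibleY _ _ _ _)
    _ ≤ ∑ i ∈ G, ‖g i - m‖ ^ 2 := sum_norm_sub_mean_sq_le _ _ _
    _ ≤ ∑ i ∈ G, ρ ^ 2 := Finset.sum_le_sum fun i hi => by gcongr; exact hg i hi
    _ = _ := by simp

theorem FilterInvariant.card_sdiff_pos (h : FilterInvariant 𝒦 B A c) (hK : 0 < 𝒦.card)
    (hb : ((𝒦 ∩ B).card : ℝ) / 𝒦.card ≤ epst) (he : epst ≤ 1 / 4) : (A \ B).Nonempty := by
  have hK' : (0 : ℝ) < 𝒦.card := by exact_mod_cast hK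
  rw [div_le_iff₀ hK'] at hb
  have := h.card_sdiff_le
  rw [← Finset.card_pos]
  have h2 : (0 : ℝ) < (A \ B).card := by nlinarith
  exact_mod_cast h2

/-- The uniform weights on the remaining clients outside `B` are feasible. -/
theorem FilterInvariant.one_div_card_le (h : FilterInvariant 𝒦 B A c) (hK : 0 < 𝒦.card)
    (hb : ((𝒦 ∩ B).card : ℝ) / 𝒦.card ≤ epst) (he : epst ≤ 1 / 4) :
    1 / ((A \ B).card : ℝ)
      ≤ (4 - (1 - epst)) / ((1 - epst) * (2 + (1 - epst)) * 𝒦.card) := by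
  have hpos : (0 : ℝ) < (A \ B).card := by
    exact_mod_cast (h.card_sdiff_pos hK hb he).card_pos
  have he0 : 0 ≤ epst := le_trans (by positivity) hb
  have hK' : (0 : ℝ) < 𝒦.card := by exact_mod_cast hK
  rw [div_le_iff₀ hK'] at hb
  have h1 := h.card_sdiff_le
  have h2 : 0 < (1 - epst) * (2 + (1 - epst)) * 𝒦.card := by
    have : 0 < 1 - epst := by linarith
    positivity
  rw [div_le_div_iff₀ hpos h2]
  have h3 : (1 - 18 / 17 * epst) * 𝒦.card ≤ ((A \ B).card : ℝ) := by linarith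
  have h4 : (1 - epst) * (2 + (1 - epst)) ≤ (4 - (1 - epst)) * (1 - 18 / 17 * epst) := by
    nlinarith
  calc 1 * ((1 - epst) * (2 + (1 - epst)) * (𝒦.card : ℝ))
      ≤ (4 - (1 - epst)) * (1 - 18 / 17 * epst) * 𝒦.card := by rw [one_mul]; gcongr
    _ ≤ (4 - (1 - epst)) * (A \ B).card := by
      rw [mul_assoc]
      have : 0 ≤ 4 - (1 - epst) := by linarith
      gcongr

/-- Coefficients drop by `c_i τ_i / τmax`, so the two groups lose mass in proportion to their shares
of the cost. The honest share is at most `K ρ²`, while the total exceeds `4 K σ² ≥ 35 K ρ²`. Removal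
only helps: an honest loss above `1/2` is recorded as `1/2`, a corrupt one is raised to `1`. -/
theorem FilterInvariant.step {A' : Finset ι} {c' : ι → ℝ} {τmax : ℝ}
    (h : FilterInvariant 𝒦 B A c) (hK : 0 < 𝒦.card)
    (hb : ((𝒦 ∩ B).card : ℝ) / 𝒦.card ≤ epst) (he : epst ≤ 1 / 4)
    (hρ : 35 * ρ ^ 2 ≤ 4 * σ ^ 2) (hg : ∀ i ∈ 𝒦 \ B, ‖g i - m‖ ≤ ρ)
    (hs : IsSaddle (1 - epst) 𝒦.card g A c W Y)
    (hgt : 4 * 𝒦.card * σ ^ 2 < ∑ i ∈ A, c i * tau g A W Y i)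
    (hmax : IsGreatest (tau g A W Y '' (A : Set ι)) τmax)
    (hc' : ∀ i ∈ A, c' i = (1 - tau g A W Y i / τmax) * c i)
    (hA' : ∀ i, i ∈ A' ↔ i ∈ A ∧ 1 / 2 ≤ c' i) : FilterInvariant 𝒦 B A' c' := by
  have hτ0 : ∀ i, 0 ≤ tau g A W Y i := tau_nonneg hs.feasibleY.1 g A W
  have hτle : ∀ i ∈ A, tau g A W Y i ≤ τmax := fun i hi => hmax.2 ⟨i, hi, rfl⟩
  have hc0 : ∀ i ∈ A, 0 ≤ c i := fun i hi => le_trans (by norm_num) (h.half_le i hi)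
  have hτm : 0 < τmax := by
    by_contra hneg
    have : ∑ i ∈ A, c i * tau g A W Y i ≤ 0 := Finset.sum_nonpos fun i hi =>
      mul_nonpos_of_nonneg_of_nonpos (hc0 i hi) ((hτle i hi).trans (not_lt.1 hneg))
    have : 0 ≤ 4 * (𝒦.card : ℝ) * σ ^ 2 := by positivity
    linarith
  have hdec : ∀ i ∈ A, c' i = c i - c i * tau g A W Y i / τmax := fun i hi => by
    rw [hc' i hi]; ring
  have hloss : ∀ i ∈ A, 0 ≤ c i * tau g A W Y i / τmax := fun i hi =>
    div_nonneg (mul_nonneg (hc0 i hi) (hτ0 i)) hτm.le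
  have hc'0 : ∀ i ∈ A, 0 ≤ c' i := fun i hi => by
    rw [hc' i hi]
    exact mul_nonneg (sub_nonneg.2 ((div_le_one hτm).2 (hτle i hi))) (hc0 i hi)
  have hA'A : A' ⊆ A := fun i hi => ((hA' i).1 hi).1
  refine ⟨hA'A.trans h.subset, fun i hi => ((hA' i).1 hi).2, fun i hi => ?_, ?_⟩
  · have := hA'A hi
    linarith [hdec i this, hloss i this, h.le_one i this]
  have hratio : ∑ i ∈ A \ B, c i * tau g A W Y i
      ≤ 1 / 34 * ∑ i ∈ A ∩ B, c i * tau g A W Y i := by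
    have h1 := IsSaddle.sum_sdiff_le hs (h.card_sdiff_pos hK hb he) (h.one_div_card_le hK hb he)
      h.le_one fun i hi => hg i (Finset.sdiff_subset_sdiff h.subset subset_rfl hi)
    have h2 : ((A \ B).card : ℝ) * ρ ^ 2 ≤ 𝒦.card * ρ ^ 2 := by
      gcongr
      exact Finset.sdiff_subset.trans h.subset
    rw [← Finset.sum_inter_add_sum_sdiff A B] at hgt
    have h3 : 𝒦.card * (35 * ρ ^ 2) ≤ 𝒦.card * (4 * σ ^ 2) := by gcongr
    linarith
  have hgood : ∑ i ∈ 𝒦 \ B, (if i ∈ A' then 1 - c' i else 1 / 2)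
      ≤ ∑ i ∈ 𝒦 \ B, (if i ∈ A then 1 - c i else 1 / 2)
        + ∑ i ∈ A \ B, c i * tau g A W Y i / τmax := by
    have e1 : ∑ i ∈ A \ B, c i * tau g A W Y i / τmax
        = ∑ i ∈ 𝒦 \ B, (if i ∈ A then c i * tau g A W Y i / τmax else 0) := by
      rw [← Finset.sum_filter]
      refine Finset.sum_congr ?_ fun _ _ => rfl
      ext i
      simp only [Finset.mem_sdiff, Finset.mem_filter]
      exact ⟨fun hi => ⟨⟨h.subset hi.1, hi.2⟩, hi.1⟩, fun hi => ⟨hi.2, hi.1.2⟩⟩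
    rw [e1, ← Finset.sum_add_distrib]
    refine Finset.sum_le_sum fun i _ => ?_
    by_cases hiA : i ∈ A
    · rw [if_pos hiA, if_pos hiA]
      have := hdec i hiA
      split_ifs with hi
      · linarith
      · have : c' i < 1 / 2 := not_le.1 fun hle => hi ((hA' i).2 ⟨hiA, hle⟩)
        linarith
    · rw [if_neg hiA, if_neg hiA, if_neg fun hi => hiA (hA'A hi), add_zero]
  have hbad : ∑ i ∈ 𝒦 ∩ B, (if i ∈ A then 1 - c i else 1)
        + ∑ i ∈ A ∩ B, c i * tau g A W Y i / τmax
      ≤ ∑ i ∈ 𝒦 ∩ B, (if i ∈ A' then 1 - c' i else 1) := by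
    have e1 : ∑ i ∈ A ∩ B, c i * tau g A W Y i / τmax
        = ∑ i ∈ 𝒦 ∩ B, (if i ∈ A then c i * tau g A W Y i / τmax else 0) := by
      rw [← Finset.sum_filter]
      refine Finset.sum_congr ?_ fun _ _ => rfl
      ext i
      simp only [Finset.mem_inter, Finset.mem_filter]
      exact ⟨fun hi => ⟨⟨h.subset hi.1, hi.2⟩, hi.1⟩, fun hi => ⟨hi.2, hi.1.2⟩⟩
    rw [e1, ← Finset.sum_add_distrib]
    refine Finset.sum_le_sum fun i _ => ?_
    by_cases hiA : i ∈ A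
    · rw [if_pos hiA, if_pos hiA]
      have := hdec i hiA
      have := hc'0 i hiA
      split_ifs with hi <;> linarith
    · rw [if_neg hiA, if_neg hiA, if_neg fun hi => hiA (hA'A hi), add_zero]
  rw [← Finset.sum_div] at hgood hbad
  have := div_le_div_of_nonneg_right hratio hτm.le
  rw [mul_div_assoc] at this
  linarith [h.mass]

/-- A corrupt vector is its residual plus a weighted mean of the remaining vectors. The cap bounds
the corrupt part of that mean by `cap · V`, with `V` the sum to be estimated. Since `|A ∩ B| · cap ≤
13/33 < 1`, the resulting `V` on the right is absorbed on the left. -/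
theorem abs_sum_le_of_filter_stops (h : FilterInvariant 𝒦 B A c) (hK : 0 < 𝒦.card)
    (hb : ((𝒦 ∩ B).card : ℝ) / 𝒦.card ≤ epst) (he : epst ≤ 1 / 4) (hσ : 0 ≤ σ) (hρ0 : 0 ≤ ρ)
    (hg : ∀ i ∈ 𝒦 \ B, ‖g i - m‖ ≤ ρ)
    (hs : IsSaddle (1 - epst) 𝒦.card g A c W Y)
    (hle : ∑ i ∈ A, c i * tau g A W Y i ≤ 4 * 𝒦.card * σ ^ 2) {u : Vec d} (hu : ‖u‖ = 1) :
    (𝒦.card - 52 / 33 * (A ∩ B).card) * ∑ i ∈ A ∩ B, |inner ℝ u (g i - m)|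
      ≤ 𝒦.card * (1415 / 1000 * 𝒦.card * σ + (A ∩ B).card * ρ) := by
  have hK' : (0 : ℝ) < 𝒦.card := by exact_mod_cast hK
  have he0 : 0 ≤ epst := le_trans (by positivity) hb
  set v : ι → ℝ := fun i => inner ℝ u (g i - m) with hv
  set r : ι → ℝ := fun i => inner ℝ u (resid g A W i) with hr
  set cap := (4 - (1 - epst)) / ((1 - epst) * (2 + (1 - epst)) * 𝒦.card) with hcap
  set V := ∑ i ∈ A ∩ B, |v i|
  have hV0 : 0 ≤ V := Finset.sum_nonneg fun _ _ => abs_nonneg _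
  set q : ℝ := ((A ∩ B).card : ℝ)
  have hq0 : 0 ≤ q := Nat.cast_nonneg _
  have hq : q ≤ 1 / 4 * 𝒦.card := by
    have h1 : q ≤ (𝒦 ∩ B).card := by
      exact Nat.cast_le.2 (Finset.card_le_card (Finset.inter_subset_inter h.subset subset_rfl))
    rw [div_le_iff₀ hK'] at hb
    nlinarith
  -- `52/33` is the value of `(4 - α) / (α (2 + α))` at the extreme `α = 3/4`.
  have hcapK : cap * 𝒦.card ≤ 52 / 33 := by
    have h0 : 0 < (1 - epst) * (2 + (1 - epst)) := by
      have : 0 < 1 - epst := by linarith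
      positivity
    have : cap * 𝒦.card = (4 - (1 - epst)) / ((1 - epst) * (2 + (1 - epst))) := by
      rw [hcap]; field_simp
    rw [this, div_le_div_iff₀ h0 (by norm_num)]
    nlinarith
  have hcap0 : 0 ≤ cap := by
    have : 0 < 1 - epst := by linarith
    have : 0 ≤ 4 - (1 - epst) := by linarith
    positivity
  have hvr : ∀ i ∈ A, v i = r i + ∑ j ∈ A, W j i * v j := fun i hi => by
    have h1 : resid g A W i = (g i - m) - ∑ j ∈ A, W j i • (g j - m) := by
      simp only [smul_sub, Finset.sum_sub_distrib, ← Finset.sum_smul,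
        (hs.feasibleW i hi).2, one_smul, resid]
      abel
    simp only [hr, h1, inner_sub_right, inner_sum, inner_smul_right, hv]
    ring
  have hvi : ∀ i ∈ A ∩ B, |v i| ≤ |r i| + (cap * V + ρ) := fun i hi => by
    have hiA := (Finset.mem_inter.1 hi).1
    have hw := hs.feasibleW i hiA
    rw [hvr i hiA]
    refine (abs_add_le _ _).trans ?_
    gcongr
    refine (Finset.abs_sum_le_sum_abs _ _).trans ?_
    rw [← Finset.sum_inter_add_sum_sdiff A B]
    gcongr
    · rw [Finset.mul_sum]
      refine Finset.sum_le_sum fun j hj => ?_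
      have := hw.1 j (Finset.mem_inter.1 hj).1
      rw [abs_mul, abs_of_nonneg this.1]
      gcongr
      exact this.2
    · calc ∑ j ∈ A \ B, |W j i * v j| ≤ ∑ j ∈ A \ B, W j i * ρ := by
            refine Finset.sum_le_sum fun j hj => ?_
            rw [abs_mul, abs_of_nonneg (hw.1 j (Finset.mem_sdiff.1 hj).1).1]
            refine mul_le_mul_of_nonneg_left ?_ (hw.1 j (Finset.mem_sdiff.1 hj).1).1
            refine (abs_real_inner_le_norm _ _).trans ?_
            rw [hu, one_mul]
            exact hg j (Finset.sdiff_subset_sdiff h.subset subset_rfl hj)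
        _ ≤ ∑ j ∈ A, W j i * ρ :=
            Finset.sum_le_sum_of_subset_of_nonneg Finset.sdiff_subset fun j hj _ =>
              mul_nonneg (hw.1 j hj).1 hρ0
        _ = ρ := by rw [← Finset.sum_mul, hw.2, one_mul]
  have hsq : ∑ i ∈ A ∩ B, r i ^ 2 ≤ 8 * 𝒦.card * σ ^ 2 := by
    have h1 := hs.isMax _ (feasibleY_vecMulVec hu)
    simp only [cost, tau_vecMulVec] at h1
    have h2 : ∑ i ∈ A ∩ B, r i ^ 2 ≤ ∑ i ∈ A, 2 * (c i * r i ^ 2) := by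
      calc _ ≤ ∑ i ∈ A, r i ^ 2 := Finset.sum_le_sum_of_subset_of_nonneg Finset.inter_subset_left
            fun _ _ _ => sq_nonneg _
        _ ≤ _ := Finset.sum_le_sum fun i hi => by nlinarith [h.half_le i hi, sq_nonneg (r i)]
    rw [← Finset.mul_sum] at h2
    linarith
  -- Cauchy–Schwarz over at most `K/4` terms gives `√2 K σ`; `1415/1000` rounds `√2` up.
  have hr1 : ∑ i ∈ A ∩ B, |r i| ≤ 1415 / 1000 * 𝒦.card * σ := by
    refine abs_le_of_sq_le_sq' ?_ (by positivity) |>.2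
    calc (∑ i ∈ A ∩ B, |r i|) ^ 2 ≤ q * ∑ i ∈ A ∩ B, |r i| ^ 2 := sq_sum_le_card_mul_sum_sq
      _ ≤ (1 / 4 * 𝒦.card) * (8 * 𝒦.card * σ ^ 2) := by simp only [sq_abs]; gcongr
      _ ≤ (1415 / 1000 * 𝒦.card * σ) ^ 2 := by
        have : 0 ≤ (𝒦.card * σ) ^ 2 := by positivity
        linarith
  have hsum := Finset.sum_le_sum hvi
  rw [Finset.sum_add_distrib, Finset.sum_const, nsmul_eq_mul] at hsum
  change V ≤ _ + q * (cap * V + ρ) at hsum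
  have h1 : 𝒦.card * V ≤ 𝒦.card * (1415 / 1000 * 𝒦.card * σ + q * (cap * V + ρ)) := by
    gcongr
    linarith
  have h2 : q * V * (cap * 𝒦.card) ≤ q * V * (52 / 33) := by gcongr
  linarith

/-- When the filter stops, the mean of the remaining vectors is close to the ball containing the
vectors of the clients outside `B`. -/
theorem norm_mean_sub_le_of_filter_stops (h : FilterInvariant 𝒦 B A c) (hK : 0 < 𝒦.card)
    (hb : ((𝒦 ∩ B).card : ℝ) / 𝒦.card ≤ epst) (he : epst ≤ 1 / 4) (hσ : 0 ≤ σ) (hρ0 : 0 ≤ ρ)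
    (hg : ∀ i ∈ 𝒦 \ B, ‖g i - m‖ ≤ ρ)
    (hs : IsSaddle (1 - epst) 𝒦.card g A c W Y)
    (hle : ∑ i ∈ A, c i * tau g A W Y i ≤ 4 * 𝒦.card * σ ^ 2) :
    ‖(1 / (A.card : ℝ)) • ∑ i ∈ A, g i - m‖ ≤ 12 / 5 * σ + 117 / 100 * ρ := by
  set w := (1 / (A.card : ℝ)) • ∑ i ∈ A, g i - m with hw
  rcases eq_or_ne w 0 with h0 | h0
  · rw [h0, norm_zero]; positivity
  set u := ‖w‖⁻¹ • w with hu
  have hu1 : ‖u‖ = 1 := norm_smul_inv_norm h0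
  have huw : inner ℝ u w = ‖w‖ := by
    rw [hu, real_inner_smul_left, real_inner_self_eq_norm_sq]
    field_simp
  have hK' : (0 : ℝ) < 𝒦.card := by exact_mod_cast hK
  have hsc := h.card_sdiff_le
  have hbK := hb
  rw [div_le_iff₀ hK'] at hbK
  have hb4 : ((𝒦 ∩ B).card : ℝ) ≤ 1 / 4 * 𝒦.card := hbK.trans (by gcongr)
  have hq : ((A ∩ B).card : ℝ) ≤ 1 / 4 * 𝒦.card := by
    refine le_trans ?_ hb4
    exact_mod_cast Finset.card_le_card (Finset.inter_subset_inter h.subset subset_rfl)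
  have hN : (A.card : ℝ) = (A ∩ B).card + (A \ B).card := by
    exact_mod_cast (Finset.card_inter_add_card_sdiff A B).symm
  have hq0 : (0 : ℝ) ≤ (A ∩ B).card := Nat.cast_nonneg _
  have hNpos : (0 : ℝ) < A.card := by linarith
  have hV := abs_sum_le_of_filter_stops h hK hb he hσ hρ0 hg hs hle hu1
  have hgood : ∑ i ∈ A \ B, inner ℝ u (g i - m) ≤ (A \ B).card * ρ := by
    rw [← nsmul_eq_mul]
    refine Finset.sum_le_card_nsmul _ _ _ fun i hi => (real_inner_le_norm _ _).trans ?_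
    rw [hu1, one_mul]
    exact hg i (Finset.sdiff_subset_sdiff h.subset subset_rfl hi)
  have hbad : ∑ i ∈ A ∩ B, inner ℝ u (g i - m) ≤ ∑ i ∈ A ∩ B, |inner ℝ u (g i - m)| :=
    Finset.sum_le_sum fun _ _ => le_abs_self _
  have hNw : A.card * ‖w‖ = ∑ i ∈ A, inner ℝ u (g i - m) := by
    rw [← inner_sum, Finset.sum_sub_distrib, Finset.sum_const, ← huw, ← inner_smul_right, hw,
      smul_sub, smul_smul, mul_one_div_cancel hNpos.ne', one_smul, Nat.cast_smul_eq_nsmul ℝ]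
  rw [← Finset.sum_inter_add_sum_sdiff A B] at hNw
  refine le_of_mul_le_mul_left ?_ hNpos
  rw [hNw]
  set q : ℝ := ((A ∩ B).card : ℝ)
  set s : ℝ := ((A \ B).card : ℝ)
  set K : ℝ := (𝒦.card : ℝ)
  have hsK : 25 / 34 * K ≤ s := by linarith
  set V : ℝ := ∑ i ∈ A ∩ B, |inner ℝ u (g i - m)|
  set D : ℝ := K - 52 / 33 * q with hD
  have hDK : 20 / 33 * K ≤ D := by linarith
  have hD0 : 0 < D := by linarith
  -- `k1` and `k2` fix the constants `12/5` and `117/100`, uniformly in `0 ≤ q ≤ K/4`.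
  have k1 : 1415 / 1000 * K ^ 2 ≤ 12 / 5 * (D * (s + q)) := by
    have e1 : D * (25 / 34 * K + q) ≤ D * (s + q) := by gcongr
    have e2 : 0 ≤ q * (1 / 4 * K - q) := mul_nonneg hq0 (by linarith)
    have e3 : 0 ≤ K * (1 / 4 * K - q) := mul_nonneg hK'.le (by linarith)
    have e4 : 0 ≤ K ^ 2 := sq_nonneg K
    rw [hD] at e1 ⊢
    linarith
  have k2 : D * s + K * q ≤ 117 / 100 * (D * (s + q)) := by
    have e1 : 20 / 33 * K * (25 / 34 * K) ≤ D * s := by gcongr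
    have e2 : 20 / 33 * K * q ≤ D * q := by gcongr
    have e3 : 0 ≤ K * (1 / 4 * K - q) := mul_nonneg hK'.le (by linarith)
    have e4 : 0 ≤ K ^ 2 := sq_nonneg K
    linarith
  have k3 := mul_le_mul_of_nonneg_right k1 hσ
  have k4 := mul_le_mul_of_nonneg_right k2 hρ0
  have k5 : D * (V + s * ρ) ≤ D * (A.card * (12 / 5 * σ + 117 / 100 * ρ)) := by
    rw [hN]
    linarith
  linarith [le_of_mul_le_mul_left k5 hD0]

theorem ByzLocalGD.IsRageOutput.norm_sub_le {out : Vec d} (h : IsRageOutput epst (σ ^ 2) 𝒦 g out)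
    (hK : 0 < 𝒦.card) (hb : ((𝒦 ∩ B).card : ℝ) / 𝒦.card ≤ epst) (he : epst ≤ 1 / 4)
    (hσ : 0 ≤ σ) (hρ0 : 0 ≤ ρ) (hρ : 35 * ρ ^ 2 ≤ 4 * σ ^ 2)
    (hg : ∀ i ∈ 𝒦 \ B, ‖g i - m‖ ≤ ρ) : ‖out - m‖ ≤ 12 / 5 * σ + 117 / 100 * ρ := by
  have key : ∀ (A : Finset ι) (c : ι → ℝ) (out : Vec d),
      RageLoop (1 - epst) (σ ^ 2) 𝒦.card g A c out → FilterInvariant 𝒦 B A c →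
      ‖out - m‖ ≤ 12 / 5 * σ + 117 / 100 * ρ := by
    intro A c out hloop
    induction hloop with
    | done A c W Y hs hle =>
      exact fun hI => norm_mean_sub_le_of_filter_stops hI hK hb he hσ hρ0 hg hs hle
    | filter A A' c c' W Y τmax out hs hgt hmax hc' hA' _ ih =>
      exact fun hI => ih (hI.step hK hb he hρ hg hs hgt hmax hc' hA')
  exact key _ _ _ h (FilterInvariant.initial _ _)

end Filter

/-! ### Error of one step of the average iterate -/

section Run

theorem norm_average_sub_le {E ι : Type*} [SeminormedAddCommGroup E] [NormedSpace ℝ E]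
    {S : Finset ι} {K : ℕ} (hK : 0 < K) (hS : S.card = K) {v : ι → E} {z : E} {b : ℝ}
    (h : ∀ r ∈ S, ‖v r - z‖ ≤ b) : ‖(1 / (K : ℝ)) • ∑ r ∈ S, v r - z‖ ≤ b := by
  have hK' : (0 : ℝ) < K := by exact_mod_cast hK
  have h1 : (1 / (K : ℝ)) • ∑ r ∈ S, v r - z = (1 / (K : ℝ)) • ∑ r ∈ S, (v r - z) := by
    rw [Finset.sum_sub_distrib, Finset.sum_const, hS, smul_sub, ← Nat.cast_smul_eq_nsmul ℝ,
      smul_smul, one_div_mul_cancel hK'.ne', one_smul]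
  rw [h1, norm_smul, Real.norm_of_nonneg (by positivity), one_div, inv_mul_le_iff₀ hK', ← hS,
    ← nsmul_eq_mul]
  exact norm_sum_le_of_le _ h |>.trans (by simp)

variable {d R : ℕ} {n : Fin R → ℕ} {f : (r : Fin R) → Fin (n r) → Vec d → ℝ}

/-- Gradient descent on `F` for `s` steps. -/
noncomputable def gradientDescent (F : Vec d → ℝ) (η : ℝ) (x : Vec d) (s : ℕ) : Vec d :=
  (fun z => z - η • gradient F z)^[s] x

theorem gradientDescent_succ (F : Vec d → ℝ) (η : ℝ) (x : Vec d) (s : ℕ) :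
    gradientDescent F η x (s + 1)
      = gradientDescent F η x s - η • gradient F (gradientDescent F η x s) :=
  Function.iterate_succ_apply' _ _ _

theorem localModel_succ (η : ℝ) (r : Fin R) (x : Vec d) (s : ℕ) :
    localModel f η r x (s + 1)
      = localModel f η r x s - η • fullBatchGradient f r (localModel f η r x s) :=
  Function.iterate_succ_apply' _ _ _

/-- The local model of a client stays close to gradient descent on the global loss. -/
theorem norm_localModel_sub_gradientDescent_le {F : Vec d → ℝ} {η κ L : ℝ} {H : ℕ}
    (hF : IsSmoothWith F L) (hL : 0 ≤ L) (hη : 0 ≤ η) (hκ : 0 ≤ κ) (hH : η * L * H ≤ 1 / 5)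
    {r : Fin R} (hd : ∀ x, ‖fullBatchGradient f r x - gradient F x‖ ≤ κ) (x : Vec d) {s : ℕ}
    (hs : s ≤ H) :
    ‖localModel f η r x s - gradientDescent F η x s‖ ≤ 139 / 125 * (η * κ * s) := by
  -- The quadratic term stands in for the exponential growth of the drift; as `η L s ≤ 1/5`, it adds
  -- at most `14/125 · s`, hence `139/125`.
  have hind : ∀ s : ℕ, s ≤ H → ‖localModel f η r x s - gradientDescent F η x s‖
      ≤ η * κ * (s + 14 / 25 * (η * L) * s ^ 2) := by
    intro s
    induction s with
    | zero => intro _; simp [localModel, gradientDescent]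
    | succ s ih =>
      intro hs
      have ih := ih (by omega)
      set y := localModel f η r x s
      set z := gradientDescent F η x s
      have h1 : localModel f η r x (s + 1) - gradientDescent F η x (s + 1)
          = (y - z) - η • ((fullBatchGradient f r y - gradient F y)
            + (gradient F y - gradient F z)) := by
        rw [localModel_succ, gradientDescent_succ]
        module
      have h2 : ‖localModel f η r x (s + 1) - gradientDescent F η x (s + 1)‖
          ≤ ‖y - z‖ + η * (κ + L * ‖y - z‖) := by
        rw [h1]
        refine (norm_sub_le _ _).trans ?_
        rw [norm_smul, Real.norm_of_nonneg hη]
        gcongr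
        exact (norm_add_le _ _).trans (add_le_add (hd y) (hF.2 y z))
      have ha : 0 ≤ η * L := mul_nonneg hη hL
      have has : η * L * s ≤ 1 / 5 := by
        refine le_trans ?_ hH
        gcongr
        omega
      have h3 : (1 + η * L) * ‖y - z‖
          ≤ (1 + η * L) * (η * κ * (s + 14 / 25 * (η * L) * s ^ 2)) := by gcongr
      have h4 : (1 + η * L) * ((s : ℝ) + 14 / 25 * (η * L) * s ^ 2) + 1
          ≤ (s + 1) + 14 / 25 * (η * L) * (s + 1) ^ 2 := by
        have hs0 : (0 : ℝ) ≤ s := Nat.cast_nonneg s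
        have h5 : η * L * s * (η * L * s) ≤ 1 / 5 * (η * L * s) := by gcongr
        nlinarith [mul_nonneg ha hs0]
      have h6 := mul_le_mul_of_nonneg_left h4 (mul_nonneg hη hκ)
      push_cast
      linarith
  refine (hind s hs).trans ?_
  have has : η * L * s ≤ 1 / 5 := by
    refine le_trans ?_ hH
    have : 0 ≤ η * L := mul_nonneg hη hL
    gcongr
  have h1 : η * L * s * s ≤ 1 / 5 * s := by gcongr
  have h2 := mul_le_mul_of_nonneg_left h1 (mul_nonneg hη hκ)
  linarith

theorem avgIterate_mul_add {η : ℝ} {K H : ℕ} {act : ℕ → Finset (Fin R)} {x : ℕ → Vec d}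
    {k s : ℕ} (hs : s < H) : avgIterate f η K H act x (k * H + s)
      = (1 / (K : ℝ)) • ∑ r ∈ act k, localModel f η r (x k) s := by
  have h1 : (k * H + s) / H = k := by
    rw [Nat.add_comm, Nat.add_mul_div_right _ _ (by omega), Nat.div_eq_of_lt hs, zero_add]
  have h2 : (k * H + s) % H = s := by
    rw [Nat.add_comm, Nat.add_mul_mod_self_right, Nat.mod_eq_of_lt hs]
  rw [avgIterate, h1, h2]

/-- The distance of a step of the average iterate from a gradient step on the global loss,
divided by the step size, is at most this: a multiple of `κ` between the synchronization times
and of `H κ` at these times. -/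
noncomputable def stepError (H : ℕ) (κ : ℝ) (t : ℕ) : ℝ :=
  if H ∣ t + 1 then 53 / 5 * (H * κ) else 3 / 2 * κ

variable {B : Finset (Fin R)} {η κ L : ℝ} {K H T : ℕ} {act : ℕ → Finset (Fin R)}
  {x : ℕ → Vec d} {sent : ℕ → Fin R → Vec d} {F : Vec d → ℝ}

/-- Each gradient is off by `κ` at its own point, and the local models lie within twice the drift of
their average: `1 + 2 · 139/625 < 3/2`. Corrupt clients are included, since their local models in
the average also follow the descent. -/
theorem norm_avgIterate_local_step_le (hF : IsSmoothWith F L) (hL : 0 ≤ L) (hη : 0 ≤ η)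
    (hκ : 0 ≤ κ) (hH : η * L * H ≤ 1 / 5) (hK : 0 < K)
    (hd : ∀ r x, ‖fullBatchGradient f r x - gradient F x‖ ≤ κ) {k s : ℕ} (hs : s + 1 < H)
    (hc : (act k).card = K) :
    ‖avgIterate f η K H act x (k * H + (s + 1)) - (avgIterate f η K H act x (k * H + s)
      - η • gradient F (avgIterate f η K H act x (k * H + s)))‖ ≤ η * (3 / 2 * κ) := by
  rw [avgIterate_mul_add hs, avgIterate_mul_add (by omega : s < H)]
  set z := gradientDescent F η (x k) s
  set w := (1 / (K : ℝ)) • ∑ r ∈ act k, localModel f η r (x k) s with hw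
  have hy : ∀ r, ‖localModel f η r (x k) s - z‖ ≤ 139 / 125 * (η * κ * s) := fun r =>
    norm_localModel_sub_gradientDescent_le hF hL hη hκ hH (hd r) (x k) (by omega)
  have hwz : ‖w - z‖ ≤ 139 / 125 * (η * κ * s) := norm_average_sub_le hK hc fun r _ => hy r
  have h1 : (1 / (K : ℝ)) • ∑ r ∈ act k, localModel f η r (x k) (s + 1) - (w - η • gradient F w)
      = -η • ((1 / (K : ℝ)) • ∑ r ∈ act k, fullBatchGradient f r (localModel f η r (x k) s)
        - gradient F w) := by
    simp only [localModel_succ, Finset.sum_sub_distrib, smul_sub, ← hw, ← Finset.smul_sum]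
    module
  rw [h1, norm_smul, norm_neg, Real.norm_of_nonneg hη]
  gcongr
  refine norm_average_sub_le hK hc fun r _ => ?_
  have h2 : ‖localModel f η r (x k) s - w‖ ≤ 2 * (139 / 125 * (η * κ * s)) := by
    have := norm_sub_le_norm_sub_add_norm_sub (localModel f η r (x k) s) z w
    rw [norm_sub_rev z w] at this
    linarith [hy r]
  have h3 := norm_sub_le_norm_sub_add_norm_sub
    (fullBatchGradient f r (localModel f η r (x k) s))
    (gradient F (localModel f η r (x k) s)) (gradient F w)
  have h4 := hd r (localModel f η r (x k) s)
  have h5 := hF.2 (localModel f η r (x k) s) w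
  have h6 := mul_le_mul_of_nonneg_left h2 hL
  have h7 : η * L * s ≤ 1 / 5 := by
    refine le_trans ?_ hH
    have : 0 ≤ η * L := mul_nonneg hη hL
    gcongr
    omega
  have h8 := mul_le_mul_of_nonneg_right h7 hκ
  linarith

/-- Exact descent on `F` links the two sides: the filter output approximates its displacement over
`η`, and the average just before synchronization is close to its penultimate point. -/
theorem norm_avgIterate_sync_step_le (hF : IsSmoothWith F L) (hL : 0 ≤ L) (hη : 0 < η)
    (hκ : 0 ≤ κ) (hH : η * L * H ≤ 1 / 5) (hH0 : 0 < H) (hK : 0 < K)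
    (hd : ∀ r x, ‖fullBatchGradient f r x - gradient F x‖ ≤ κ)
    (hrun : IsRun f B η (11 * H ^ 2 * κ ^ 2) K H T act x sent) {k : ℕ} (hk : (k + 1) * H ≤ T) :
    ‖avgIterate f η K H act x ((k + 1) * H) - (avgIterate f η K H act x (k * H + (H - 1))
      - η • gradient F (avgIterate f η K H act x (k * H + (H - 1))))‖
      ≤ η * (53 / 5 * (H * κ)) := by
  have hc : (act k).card = K := hrun.card_act k (le_trans (by gcongr; omega) hk)
  have hK' : (K : ℝ) ≠ 0 := by exact_mod_cast hK.ne'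
  have hnext : avgIterate f η K H act x ((k + 1) * H) = x (k + 1) := by
    have := avgIterate_mul_add (f := f) (η := η) (K := K) (act := act) (x := x) (k := k + 1) hH0
    rw [add_zero] at this
    rw [this]
    simp only [localModel, Function.iterate_zero, id_eq, Finset.sum_const]
    rw [hrun.card_act _ hk, ← Nat.cast_smul_eq_nsmul ℝ, smul_smul, one_div_mul_cancel hK', one_smul]
  rw [hnext, avgIterate_mul_add (by omega : H - 1 < H)]
  set w := (1 / (K : ℝ)) • ∑ r ∈ act k, localModel f η r (x k) (H - 1)
  set z := gradientDescent F η (x k) (H - 1) with hz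
  set zH := gradientDescent F η (x k) H with hzH
  have hzz : zH = z - η • gradient F z := by
    rw [hzH, hz, ← gradientDescent_succ, Nat.sub_add_cancel hH0]
  have hHκ : 0 ≤ H * κ := by positivity
  have hwz : ‖w - z‖ ≤ 139 / 125 * (η * κ * H) := by
    refine norm_average_sub_le hK hc fun r _ => ?_
    refine (norm_localModel_sub_gradientDescent_le hF hL hη.le hκ hH (hd r) (x k)
      (by omega)).trans ?_
    gcongr
    omega
  obtain ⟨epst, ghat, hb, he, hout, hx⟩ := hrun.update k hk
  set σ := √11 * (H * κ) with hσ
  have hσ2 : 11 * (H : ℝ) ^ 2 * κ ^ 2 = σ ^ 2 := by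
    rw [hσ, mul_pow, Real.sq_sqrt (by norm_num)]; ring
  rw [hσ2] at hout
  set ρ := 139 / 125 * (H * κ) with hρ
  set m := (1 / η) • (x k - zH) with hm
  have hfil : ‖ghat - m‖ ≤ 12 / 5 * σ + 117 / 100 * ρ := by
    refine IsRageOutput.norm_sub_le (B := B) hout (by omega) (by rwa [hc]) he (by positivity)
      (by positivity) ?_ fun r hr => ?_
    -- `35 · (139/125)² < 44 = 4 · 11`: this is what the size of `σ₀²` is for.
    · rw [← hσ2, hρ]
      nlinarith [sq_nonneg (H * κ)]
    · rw [Finset.mem_sdiff] at hr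
      have h1 : (1 / η) • (x k - sent k r) - m = -(1 / η) • (localModel f η r (x k) H - zH) := by
        rw [hrun.honest k hk r hr.1 hr.2, hm]
        module
      rw [h1, norm_smul, norm_neg, Real.norm_of_nonneg (by positivity), one_div,
        inv_mul_le_iff₀ hη]
      refine (norm_localModel_sub_gradientDescent_le hF hL hη.le hκ hH (hd r) (x k)
        le_rfl).trans_eq ?_
      rw [hρ]
      ring
  have hdecomp : x (k + 1) - (w - η • gradient F w)
      = -η • (ghat - m) + (-(w - z) + η • (gradient F w - gradient F z)) := by
    have hηm : η • m = x k - zH := by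
      rw [hm, smul_smul, mul_one_div_cancel hη.ne', one_smul]
    rw [smul_sub, neg_smul η m, hηm, hx, hzz]
    module
  have h11 : √11 ≤ 3317 / 1000 := by
    rw [Real.sqrt_le_left (by norm_num)]
    norm_num
  have h1 : ‖x (k + 1) - (w - η • gradient F w)‖
      ≤ η * ‖ghat - m‖ + (‖w - z‖ + η * (L * ‖w - z‖)) := by
    rw [hdecomp]
    refine (norm_add_le _ _).trans (add_le_add ?_ ((norm_add_le _ _).trans (add_le_add ?_ ?_)))
    · rw [norm_smul, norm_neg, Real.norm_of_nonneg hη.le]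
    · rw [norm_neg]
    · rw [norm_smul, Real.norm_of_nonneg hη.le]
      gcongr
      exact hF.2 w z
  have h2 : η * L ≤ 1 / 5 := by
    refine le_trans ?_ hH
    refine le_mul_of_one_le_right (by positivity) ?_
    exact_mod_cast hH0
  have h3 : η * L * ‖w - z‖ ≤ 1 / 5 * ‖w - z‖ := by gcongr
  have h4 : σ ≤ 3317 / 1000 * (H * κ) := by rw [hσ]; gcongr
  have h5 : η * ‖ghat - m‖ ≤ η * (12 / 5 * (3317 / 1000 * (H * κ)) + 117 / 100 * ρ) := by
    gcongr
    linarith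
  have h6 : 0 ≤ η * (H * κ) := by positivity
  -- The filter error and `6/5` of the drift add up to less than `53/5`.
  rw [hρ] at h5
  linarith

theorem norm_avgIterate_step_le (hF : IsSmoothWith F L) (hL : 0 ≤ L) (hη : 0 < η)
    (hκ : 0 ≤ κ) (hH : η * L * H ≤ 1 / 5) (hH0 : 0 < H) (hK : 0 < K)
    (hd : ∀ r x, ‖fullBatchGradient f r x - gradient F x‖ ≤ κ)
    (hrun : IsRun f B η (11 * H ^ 2 * κ ^ 2) K H T act x sent) {t : ℕ} (ht : t < T) :
    ‖avgIterate f η K H act x (t + 1) - (avgIterate f η K H act x t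
      - η • gradient F (avgIterate f η K H act x t))‖ ≤ η * stepError H κ t := by
  obtain ⟨k, s, hs, rfl⟩ : ∃ k s, s < H ∧ t = k * H + s :=
    ⟨t / H, t % H, Nat.mod_lt _ hH0, (Nat.div_add_mod' t H).symm⟩
  have hdvd : H ∣ k * H + s + 1 ↔ s + 1 = H := by
    rw [add_assoc, Nat.dvd_add_right (Dvd.intro_left k rfl)]
    exact ⟨fun h => le_antisymm hs (Nat.le_of_dvd (Nat.succ_pos s) h), fun h => h ▸ dvd_rfl⟩
  by_cases h : s + 1 = H
  · rw [stepError, if_pos (hdvd.2 h)]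
    have e1 : k * H + s + 1 = (k + 1) * H := by rw [add_mul]; omega
    have e2 : s = H - 1 := by omega
    rw [e1, e2]
    exact norm_avgIterate_sync_step_le hF hL hη hκ hH hH0 hK hd hrun (by omega)
  · rw [stepError, if_neg (mt hdvd.1 h)]
    exact norm_avgIterate_local_step_le hF hL hη.le hκ hH hK hd (by omega)
      (hrun.card_act k (by omega))

/-- There are `⌊T/H⌋` synchronizations, and `(53/5)² + 9/4 < 115`. -/
theorem sum_stepError_sq_le (hH0 : 0 < H) (κ : ℝ) (T : ℕ) :
    ∑ t ∈ Finset.range T, stepError H κ t ^ 2 ≤ 115 * H * κ ^ 2 * T := by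
  have hH1 : (1 : ℝ) ≤ H := by exact_mod_cast hH0
  have hκ2 : 0 ≤ κ ^ 2 := sq_nonneg κ
  have hind : ∑ t ∈ Finset.range T, stepError H κ t ^ 2
      ≤ (T / H : ℕ) * (53 / 5 * (H * κ)) ^ 2 + T * (3 / 2 * κ) ^ 2 := by
    induction T with
    | zero => simp
    | succ T ih =>
      rw [Finset.sum_range_succ, Nat.succ_div, stepError]
      split_ifs
      · push_cast
        nlinarith [sq_nonneg (3 / 2 * κ)]
      · push_cast
        linarith
  have hdiv : ((T / H : ℕ) : ℝ) * H ≤ T := by exact_mod_cast Nat.div_mul_le_self T H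
  have h1 := mul_le_mul_of_nonneg_right hdiv (mul_nonneg (by linarith : (0 : ℝ) ≤ H) hκ2)
  have h2 : κ ^ 2 * T * 1 ≤ κ ^ 2 * T * H := by gcongr
  nlinarith

/-- A contraction with a small error at each time and a larger one at the multiples of `H`. -/
theorem le_of_contraction_periodic {a : ℕ → ℝ} {q b b' V : ℝ} (hH0 : 0 < H) (hq0 : 0 ≤ q)
    (hq1 : q ≤ 1) (hb : 0 ≤ b) (hV0 : 0 ≤ V)
    (hstep : ∀ t < T, a (t + 1) ≤ q * a t + if H ∣ t + 1 then b' else b)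
    (hV : q ^ H * V + H * b + b' ≤ V) : a T ≤ q ^ T * a 0 + V + H * b := by
  -- Within a round the excess `V` decays while `b` accumulates; `hV` says that closing the round,
  -- with `b'` paid once, restores at most `V`.
  have hind : ∀ t ≤ T, a t ≤ q ^ t * a 0 + q ^ (t % H) * V + (t % H : ℕ) * b := by
    intro t
    induction t with
    | zero => intro _; simpa using hV0
    | succ t ih =>
      intro ht
      have h1 := mul_le_mul_of_nonneg_left (ih (by omega)) hq0
      have h2 := hstep t (by omega)
      have hr : ((t % H : ℕ) : ℝ) * b * q ≤ (t % H : ℕ) * b :=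
        mul_le_of_le_one_right (by positivity) hq1
      by_cases hd : H ∣ t + 1
      · rw [if_pos hd] at h2
        have hmod : t % H + 1 = H := by
          have h3 : H ∣ t % H + 1 := by
            rw [← Nat.div_add_mod' t H, add_assoc, Nat.dvd_add_right (Dvd.intro_left _ rfl)] at hd
            exact hd
          exact le_antisymm (Nat.mod_lt t hH0) (Nat.le_of_dvd (Nat.succ_pos _) h3)
        have h4 : q ^ H = q * q ^ (t % H) := by rw [← pow_succ', hmod]
        have h5 : ((t % H : ℕ) : ℝ) + 1 = H := by exact_mod_cast hmod
        rw [Nat.mod_eq_zero_of_dvd hd, pow_succ]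
        rw [h4, ← h5] at hV
        simp only [pow_zero, Nat.cast_zero]
        linarith
      · rw [if_neg hd] at h2
        have hmod : (t + 1) % H = t % H + 1 := by
          have hne : t % H + 1 ≠ H := fun h => hd <| by
            rw [Nat.dvd_iff_mod_eq_zero, ← Nat.mod_add_mod, h, Nat.mod_self]
          rw [← Nat.mod_add_mod, Nat.mod_eq_of_lt (lt_of_le_of_ne (Nat.mod_lt t hH0) hne)]
        rw [hmod, pow_succ, pow_succ]
        push_cast
        linarith
  have hlt : ((T % H : ℕ) : ℝ) ≤ H := by exact_mod_cast (Nat.mod_lt T hH0).le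
  have h1 : q ^ (T % H) * V ≤ V := mul_le_of_le_one_left hV0 (pow_le_one₀ hq0 hq1)
  have h2 : ((T % H : ℕ) : ℝ) * b ≤ H * b := by gcongr
  linarith [hind T le_rfl]

end Run

/-! ### Convergence from the step errors -/

section Convergence

variable {d : ℕ} {F : Vec d → ℝ} {L κ μ : ℝ} {H T : ℕ} {w : ℕ → Vec d} {xs : Vec d}

theorem sq_dist_le_of_stepError (hF : IsSmoothWith F L) (hsc : IsStronglyConvexWith F μ)
    (hμ : 0 < μ) (hL : 0 < L) (hH0 : 0 < H) (hmin : IsMinOn F Set.univ xs)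
    (hstep : ∀ t < T, ‖w (t + 1) - (w t - (1 / (5 * H * L)) • gradient F (w t))‖
      ≤ 1 / (5 * H * L) * stepError H κ t) :
    ‖w T - xs‖ ^ 2 ≤ (1 - μ / (10 * H * L)) ^ T * ‖w 0 - xs‖ ^ 2
      + 14 / μ ^ 2 * (25 * H * κ ^ 2) := by
  -- In dimension zero `μ ≤ L` can fail, but the distances vanish.
  rcases subsingleton_or_nontrivial (Vec d) with hsub | hnt
  · rw [Subsingleton.elim (w T - xs) 0, Subsingleton.elim (w 0 - xs) 0]
    simp only [norm_zero, ne_eq, OfNat.ofNat_ne_zero, not_false_eq_true, zero_pow, mul_zero,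
      zero_add]
    positivity
  have hμL : μ ≤ L := IsStronglyConvexWith.le_lipschitz hF hsc
  have hH1 : (1 : ℝ) ≤ H := by exact_mod_cast hH0
  set η := 1 / (5 * H * L) with hη
  have hη0 : 0 < η := by positivity
  have hηHL : H * (η * L) = 1 / 5 := by rw [hη]; field_simp
  have hηL : η * L ≤ 1 / 5 := by
    rw [← hηHL]
    exact le_mul_of_one_le_left (by positivity) hH1
  have hq : 1 - μ / (10 * H * L) = 1 - η * μ / 2 := by rw [hη]; field_simp; ring
  rw [hq]
  set p := η * μ / 2 with hp
  have hp0 : 0 < p := by positivity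
  have hHp : H * p ≤ 1 / 10 := by
    have : H * (η * μ) ≤ H * (η * L) := by gcongr
    rw [hp]
    linarith
  have hp1 : p ≤ 1 / 10 := (le_mul_of_one_le_left hp0.le hH1).trans hHp
  set b := η / μ * (3 / 2 * κ) ^ 2 with hb
  set b' := η / μ * (53 / 5 * (H * κ)) ^ 2 with hb'
  have hb0 : 0 ≤ b := by positivity
  have hb'0 : 0 ≤ b' := by positivity
  have hrec : ∀ t < T, ‖w (t + 1) - xs‖ ^ 2
      ≤ (1 - p) * ‖w t - xs‖ ^ 2 + if H ∣ t + 1 then b' else b := fun t ht => by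
    have := IsStronglyConvexWith.inexact_step hF hsc hμ hμL hη0 hηL hmin (hstep t ht)
    rw [stepError] at this
    split_ifs at this ⊢ <;> exact this
  have hpow : (1 - p) ^ H * (1 + H * p) ≤ 1 := by
    have h1 : 1 + H * p ≤ (1 + p) ^ H := one_add_mul_le_pow (by linarith) H
    calc (1 - p) ^ H * (1 + H * p) ≤ (1 - p) ^ H * (1 + p) ^ H := by
          have : 0 ≤ (1 - p) ^ H := pow_nonneg (by linarith) H
          gcongr
      _ = (1 - p ^ 2) ^ H := by rw [← mul_pow]; ring
      _ ≤ 1 := pow_le_one₀ (by nlinarith) (by nlinarith)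
  -- By `hpow` and `H p ≤ 1/10`, a round shrinks `V` by at least `V · H p / (11/10)`, exactly the
  -- error `H b + b'` of a round.
  set V := 11 / 10 * (H * b + b') / (H * p) with hV
  have hHp0 : 0 < H * p := by positivity
  have hV0 : 0 ≤ V := by positivity
  have hfix : (1 - p) ^ H * V + H * b + b' ≤ V := by
    have h1 : H * b + b' = V * (H * p) / (11 / 10) := by rw [hV]; field_simp
    have h2 := mul_le_mul_of_nonneg_right hpow hV0
    have h3 : (1 - p) ^ H * V * (1 + H * p) ≤ (V - V * (H * p) / (11 / 10)) * (1 + H * p) := by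
      nlinarith [mul_nonneg hV0 hHp0.le]
    have h4 := le_of_mul_le_mul_right h3 (by linarith)
    linarith
  have hmain := le_of_contraction_periodic (a := fun t => ‖w t - xs‖ ^ 2) hH0
    (by linarith : 0 ≤ 1 - p) (by linarith) hb0 hV0 hrec hfix
  refine hmain.trans ?_
  rw [add_assoc]
  gcongr
  have hVeq : V = (11 / 5 * (9 / 4) * κ ^ 2 + 11 / 5 * (53 / 5) ^ 2 * H * κ ^ 2) / μ ^ 2 := by
    rw [hV, hb, hb', hp]
    field_simp
    ring
  have hbeq : H * b = (H * (η * μ)) * (9 / 4 * κ ^ 2) / μ ^ 2 := by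
    rw [hb]
    field_simp
    ring
  have hHημ : H * (η * μ) ≤ 1 / 5 := by
    rw [hp] at hHp
    linarith
  rw [hVeq, hbeq, ← add_div, div_mul_eq_mul_div 14]
  gcongr
  have h1 : H * (η * μ) * (9 / 4 * κ ^ 2) ≤ 1 / 5 * (9 / 4 * κ ^ 2) := by gcongr
  have h2 : 1 * κ ^ 2 ≤ H * κ ^ 2 := by gcongr
  linarith [sq_nonneg κ]

theorem sum_sq_gradient_le_of_stepError (hF : IsSmoothWith F L) (hL : 0 < L) (hH0 : 0 < H)
    (hT : 0 < T) (hmin : IsMinOn F Set.univ xs)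
    (hstep : ∀ t < T, ‖w (t + 1) - (w t - (1 / (5 * H * L)) • gradient F (w t))‖
      ≤ 1 / (5 * H * L) * stepError H κ t) :
    1 / (T : ℝ) * ∑ t ∈ Finset.range (T + 1), ‖gradient F (w t)‖ ^ 2
      ≤ 10 * H * L / T * (F (w 0) - F xs) + 24 / 5 * (25 * H * κ ^ 2) := by
  have hH1 : (1 : ℝ) ≤ H := by exact_mod_cast hH0
  have hT' : (0 : ℝ) < T := by exact_mod_cast hT
  have hη0 : 0 < 1 / (5 * H * L) := by positivity
  have hηL : 1 / (5 * H * L) * L ≤ 1 := by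
    rw [div_mul_eq_mul_div, one_mul, div_le_one (by positivity)]
    nlinarith
  have hone : ∀ t < T, ‖gradient F (w t)‖ ^ 2
      ≤ 10 * H * L * (F (w t) - F (w (t + 1))) + stepError H κ t ^ 2 := fun t ht => by
    have h1 := mul_le_mul_of_nonneg_left (hF.inexact_step hη0.le hηL (hstep t ht))
      (by positivity : 0 ≤ 10 * H * L)
    have h2 : 10 * H * L * (1 / (5 * H * L) / 2) = 1 := by field_simp; norm_num
    have h3 : 10 * H * L * (F (w t) - 1 / (5 * H * L) / 2 * ‖gradient F (w t)‖ ^ 2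
        + 1 / (5 * H * L) / 2 * stepError H κ t ^ 2)
        = 10 * H * L * F (w t) - (10 * H * L * (1 / (5 * H * L) / 2)) * ‖gradient F (w t)‖ ^ 2
          + (10 * H * L * (1 / (5 * H * L) / 2)) * stepError H κ t ^ 2 := by ring
    rw [h3, h2] at h1
    linarith
  have hsum : ∑ t ∈ Finset.range T, ‖gradient F (w t)‖ ^ 2
      ≤ 10 * H * L * (F (w 0) - F (w T)) + 115 * H * κ ^ 2 * T := by
    refine (Finset.sum_le_sum fun t ht => hone t (Finset.mem_range.1 ht)).trans ?_
    rw [Finset.sum_add_distrib, ← Finset.mul_sum, Finset.sum_range_sub' (fun t => F (w t))]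
    linarith [sum_stepError_sq_le hH0 κ T]
  -- The sum has `T + 1` terms; the last is paid for by the gap `F (w T) - F xs` left over from
  -- telescoping.
  have hlast : ‖gradient F (w T)‖ ^ 2 ≤ 10 * H * L * (F (w T) - F xs) := by
    refine (hF.norm_gradient_sq_le hL hmin (w T)).trans ?_
    have h0 : 0 ≤ F (w T) - F xs := sub_nonneg.2 ((isMinOn_iff.1 hmin) _ (Set.mem_univ _))
    gcongr
    linarith
  have hκ2 : 0 ≤ H * κ ^ 2 * T := by positivity
  rw [Finset.sum_range_succ, one_div, inv_mul_le_iff₀ hT']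
  have : T * (10 * H * L / T * (F (w 0) - F xs) + 24 / 5 * (25 * H * κ ^ 2))
      = 10 * H * L * (F (w 0) - F xs) + 120 * H * κ ^ 2 * T := by
    field_simp
    ring
  rw [this]
  linarith

end Convergence

theorem ByzLocalGD.le_Gam (Ups : ℝ) (H : ℕ) (κ : ℝ) : 25 * H * κ ^ 2 ≤ Gam Ups H κ := by
  have : 0 ≤ 2 * Ups ^ 2 / H := by positivity
  rw [Gam]
  linarith

/-- The constant `C` hidden in `Υ_GD = O(H κ √ε)` is absolute. The bounds hold for every run of the
scheme, whatever the server selects and the corrupt clients send, hence with probability one. -/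
theorem theorem2 :
    ∃ C : ℝ, 0 ≤ C ∧
      ∀ (d R K H T : ℕ) (n : Fin R → ℕ) (f : (r : Fin R) → Fin (n r) → Vec d → ℝ)
        (B : Finset (Fin R)) (ε κ L : ℝ)
        (act : ℕ → Finset (Fin R)) (x : ℕ → Vec d) (sent : ℕ → Fin R → Vec d)
        (xstar : Vec d),
        0 < K → K ≤ R → 0 < H →
        (∀ r, 0 < n r) → (∀ r i, Differentiable ℝ (f r i)) →
        0 ≤ κ → BoundedDissimilarity f κ →
        0 < L → IsSmoothWith (globalLoss f) L →
        IsMinOn (globalLoss f) Set.univ xstar →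
        ε = (B.card : ℝ) / R → ε ≤ (K : ℝ) / (4 * R) →
        IsRun f B (1 / (5 * H * L)) (11 * H ^ 2 * κ ^ 2) K H T act x sent →
        (∀ μ : ℝ, 0 < μ → IsStronglyConvexWith (globalLoss f) μ →
          ‖avgIterate f (1 / (5 * H * L)) K H act x T - xstar‖ ^ 2
            ≤ (1 - μ / (10 * H * L)) ^ T *
                ‖avgIterate f (1 / (5 * H * L)) K H act x 0 - xstar‖ ^ 2
              + 14 / μ ^ 2 * Gam (C * (H * κ * √ε)) H κ) ∧
        (0 < T →
          1 / (T : ℝ) * ∑ t ∈ Finset.range (T + 1),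
              ‖gradient (globalLoss f) (avgIterate f (1 / (5 * H * L)) K H act x t)‖ ^ 2
            ≤ 10 * H * L / T *
                (globalLoss f (avgIterate f (1 / (5 * H * L)) K H act x 0) - globalLoss f xstar)
              + 24 / 5 * Gam (C * (H * κ * √ε)) H κ) := by
  -- The filter error is at most a multiple of `H κ` whenever at most a quarter of the selected
  -- clients is corrupt; the term `25 H κ ^ 2` of `Gam` covers it, so every `C` would do.
  refine ⟨1, zero_le_one, ?_⟩
  intro d R K H T n f B ε κ L act x sent xstar hK _ hH0 _ hf hκ hdis hL hF hmin _ _ hrun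
  have hH1 : (0 : ℝ) < H := by exact_mod_cast hH0
  have hd : ∀ r y, ‖fullBatchGradient f r y - gradient (globalLoss f) y‖ ≤ κ := fun r y => by
    rw [← gradient_localLoss hf]
    exact abs_le_of_sq_le_sq' (hdis r y) hκ |>.2
  have hη : 0 < 1 / (5 * H * L) := by positivity
  have hηH : 1 / (5 * H * L) * L * H ≤ 1 / 5 := by
    refine le_of_eq ?_
    field_simp
  have hstep : ∀ t < T, _ := fun t ht =>
    norm_avgIterate_step_le hF hL.le hη hκ hηH hH0 hK hd hrun ht
  have hGam := le_Gam (1 * (H * κ * √ε)) H κ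
  refine ⟨fun μ hμ hsc => ?_, fun hT => ?_⟩
  · refine (sq_dist_le_of_stepError hF hsc hμ hL hH0 hmin hstep).trans ?_
    gcongr
  · refine (sum_sq_gradient_le_of_stepError hF hL hH0 hT hmin hstep).trans ?_
    gcongr
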